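/- Let $\mathcal M=(Q,A,\Gamma)$ be a robust Markov decision process: $Q$ is a finite set of states, $A$ is a finite set of actions, $A(q)\subseteq A$ is the nonempty set of actions available at $q\in Q$, and for $q\in Q$, $a\in A(q)$, $\Gamma_{q,a}$ is a nonempty set of probability distributions on $Q$. A finite path is a sequence $\omega=q_0\xrightarrow{a_0}q_1\xrightarrow{a_1}\cdots\xrightarrow{a_{k-1}}q_k$ such that, for each $i<k$, $a_i\in A(q_i)$ and $\gamma(q_{i+1})>0$ for some $\gamma\in\Gamma_{q_i,a_i}$; put $\mathrm{last}(\omega)=q_k$. A strategy $\sigma\in\Sigma$ assigns to every finite path $\omega$ an action in $A(\mathrm{last}(\omega))$; it is stationary if $\sigma(\omega)$ depends only on $\mathrm{last}(\omega)$. An adversary $\xi\in\Xi$ assigns to every finite path $\omega$ and every $a\in A(\mathrm{last}(\omega))$ a distribution in $\Gamma_{\mathrm{last}(\omega),a}$. Let $P^{q,\sigma}_\xi$ be the resulting probability measure on the infinite state sequences $\omega(0)\omega(1)\cdots$ that start at $\omega(0)=q$. For $Q_{\rm tgt}\subseteq Q_{\rm safe}\subseteq Q$ let $$P_{\rm reach}(q,\sigma,\xi)=P^{q,\sigma}_\xi\big[\exists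 k\ge 0:\ \omega(k)\in Q_{\rm tgt}\ \text{and}\ \omega(k')\in Q_{\rm safe}\ \text{for all } k'<k\big]$$ be the (undiscounted) infinite-horizon reach-avoid probability. Then the infinite-horizon robust reachability problem admits an optimal stationary strategy: there is a stationary strategy $\sigma'$ such that, for every $q\in Q$, $$\inf_{\xi\in\Xi}P_{\rm reach}(q,\sigma',\xi)=\max_{\sigma\in\Sigma}\ \inf_{\xi\in\Xi}P_{\rm reach}(q,\sigma,\xi).$$ -/

import Mathlib

open MeasureTheory ProbabilityTheory
open scoped ENNReal

/-- A robust Markov decision process with state space `Q` and action space `A` (both finite in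
the theorem): `act q` is the set of actions available at `q`, and `trans q a` is the set of
transition distributions that are possible at `q` under `a`. The only structure imposed on the
ambiguity sets is rectangularity, i.e. that there is one set per state-action pair. -/
structure RobustMDP (Q A : Type*) where
  act : Q → Set A
  trans : Q → A → Set (PMF Q)
  act_nonempty : ∀ q, (act q).Nonempty
  trans_nonempty : ∀ q, ∀ a ∈ act q, (trans q a).Nonempty

/-- Finite alternating sequences `q₀ a₀ q₁ a₁ … q_k` of states and actions. -/
inductive StateActionSeq (Q A : Type*) where
  | init (q : Q) : StateActionSeq Q A
  | snoc (ω : StateActionSeq Q A) (a : A) (q : Q) : StateActionSeq Q A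

/-- The last state of a finite alternating sequence. -/
def StateActionSeq.last {Q A : Type*} : StateActionSeq Q A → Q
  | .init q => q
  | .snoc _ _ q => q

namespace RobustMDP

variable {Q A : Type*}

/-- The alternating sequence is a finite path of `M`: every action is available at the state where
it is taken, and every transition has positive probability under some admissible distribution. -/
def IsPath (M : RobustMDP Q A) : StateActionSeq Q A → Prop
  | .init _ => True
  | .snoc ω a q => M.IsPath ω ∧ a ∈ M.act ω.last ∧ ∃ γ ∈ M.trans ω.last a, 0 < γ q

/-- A strategy maps every finite path of `M` to an action available at its last state (the values
at sequences that are not paths of `M` are irrelevant and unconstrained). -/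
structure Strategy (M : RobustMDP Q A) where
  toFun : StateActionSeq Q A → A
  mem_act : ∀ ω, M.IsPath ω → toFun ω ∈ M.act ω.last

/-- A strategy is stationary if its action depends only on the last state of the path. -/
def Strategy.IsStationary {M : RobustMDP Q A} (σ : M.Strategy) : Prop :=
  ∃ f : Q → A, ∀ ω, M.IsPath ω → σ.toFun ω = f ω.last

/-- An adversary maps every finite path of `M` and every action available at its last state to an
admissible transition distribution (other values are irrelevant and unconstrained). -/
structure Adversary (M : RobustMDP Q A) where
  toFun : StateActionSeq Q A → A → PMF Q
  mem_trans : ∀ ω, M.IsPath ω → ∀ a ∈ M.act ω.last, toFun ω a ∈ M.trans ω.last a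

/-- The alternating sequence `q₀ a₀ q₁ a₁ … q_k` of length `k + 1` that arises when the visited
states are `x 0, x 1, …` and the actions are chosen by `σ`. -/
def Strategy.history {M : RobustMDP Q A} (σ : M.Strategy) (x : ℕ → Q) : ℕ → StateActionSeq Q A
  | 0 => .init (x 0)
  | k + 1 => .snoc (σ.history x k) (σ.toFun (σ.history x k)) (x (k + 1))

variable [Finite Q] [MeasurableSpace Q] [MeasurableSingletonClass Q]

/-- The conditional law of the state at time `n + 1` given the states at times `0, …, n`, when the
actions are chosen by `σ` and the transition distributions by `ξ`. -/
noncomputable def stepKernel (M : RobustMDP Q A) (σ : M.Strategy) (ξ : M.Adversary) (n : ℕ) :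
    Kernel ((_ : Finset.Iic n) → Q) Q :=
  Kernel.ofFunOfCountable fun x =>
    let ω := σ.history (fun k => x ⟨min k n, Finset.mem_Iic.2 (min_le_right k n)⟩) n
    (ξ.toFun ω (σ.toFun ω)).toMeasure

instance (M : RobustMDP Q A) (σ : M.Strategy) (ξ : M.Adversary) (n : ℕ) :
    IsMarkovKernel (M.stepKernel σ ξ n) :=
  ⟨fun _ => PMF.toMeasure.isProbabilityMeasure _⟩

/-- The law of the infinite sequence of visited states that starts at `q`, under the strategy `σ`
and the adversary `ξ` (given by the Ionescu-Tulcea theorem). -/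
noncomputable def pathMeasure (M : RobustMDP Q A) (σ : M.Strategy) (ξ : M.Adversary) (q : Q) :
    Measure (ℕ → Q) :=
  Kernel.traj (X := fun _ : ℕ => Q) (M.stepKernel σ ξ) 0 (fun _ => q)

/-- The infinite-horizon reach-avoid probability: the probability that the target set is visited
at some time, and that all states visited before that time are safe. -/
noncomputable def reachProb (M : RobustMDP Q A) (safe tgt : Set Q) (q : Q) (σ : M.Strategy)
    (ξ : M.Adversary) : ℝ≥0∞ :=
  M.pathMeasure σ ξ q {x : ℕ → Q | ∃ k, x k ∈ tgt ∧ ∀ j < k, x j ∈ safe}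

/-- The worst case of the reach-avoid probability over all adversaries. -/
noncomputable def worstReachProb (M : RobustMDP Q A) (safe tgt : Set Q) (q : Q)
    (σ : M.Strategy) : ℝ≥0∞ :=
  ⨅ ξ : M.Adversary, M.reachProb safe tgt q σ ξ

/-- `σ` is an optimal (robust) strategy: at every initial state it maximizes, among all
strategies, the worst-case reach-avoid probability. -/
def Strategy.IsOptimal {M : RobustMDP Q A} (σ : M.Strategy) (safe tgt : Set Q) : Prop :=
  ∀ q : Q, IsMaxOn (M.worstReachProb safe tgt q) Set.univ σ

end RobustMDP

/-! A greedy strategy for the undiscounted value can fail: it may circle forever among states of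
equal value. Discounting by `l < 1` removes this defect. A stationary strategy that is greedy for
the discounted value guarantees at least that value as undiscounted reach-avoid probability
(`value_le_worstReachProb`), because the part of the value not yet realised at time `n` is at most
`l ^ n`.

Let `l` increase to 1. There are finitely many maps `Q → A`, so one of them is greedy for infinitely
many discount factors, and it secures the supremum `u` of the discounted values. Conversely, `u` is
a supersolution of the undiscounted Bellman equation (`worstExp_iSup_value_le`), and a nearly
worst-case adversary holds every strategy down to a supersolution (`worstReachProb_le`). Ambiguity
sets need not be compact: infima are only approximated. -/

namespace StateActionSeq

variable {Q A : Type*}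

/-! ### Sequences frozen on leaving a set -/

/-- The number of transitions of a finite alternating sequence. -/
def length : StateActionSeq Q A → ℕ
  | .init _ => 0
  | .snoc ω _ _ => ω.length + 1

open Classical in
/-- The last state of the sequence when it is frozen at its first visit to the complement
of `C`. -/
noncomputable def stopped (C : Set Q) : StateActionSeq Q A → Q
  | .init q => q
  | .snoc ω _ q => if ω.stopped C ∈ C then q else ω.stopped C

lemma stopped_snoc_of_mem {C : Set Q} {ω : StateActionSeq Q A} (h : ω.stopped C ∈ C) (a : A)
    (q : Q) : (snoc ω a q).stopped C = q := if_pos h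

lemma stopped_snoc_of_notMem {C : Set Q} {ω : StateActionSeq Q A} (h : ω.stopped C ∉ C) (a : A)
    (q : Q) : (snoc ω a q).stopped C = ω.stopped C := if_neg h

lemma stopped_eq_last {C : Set Q} {ω : StateActionSeq Q A} (h : ω.stopped C ∈ C) :
    ω.stopped C = ω.last := by
  cases ω with
  | init q => rfl
  | snoc ω a q =>
    by_cases hω : ω.stopped C ∈ C
    · exact stopped_snoc_of_mem hω a q
    · rw [stopped_snoc_of_notMem hω] at h
      exact absurd h hω

end StateActionSeq

namespace RobustMDP

open StateActionSeq Set

variable {Q A : Type*}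

/-! ### Histories and the frozen run -/

section History

variable {M : RobustMDP Q A} (σ : M.Strategy)

lemma Strategy.history_congr {x y : ℕ → Q} {n : ℕ} (h : ∀ k ≤ n, x k = y k) :
    σ.history x n = σ.history y n := by
  induction n with
  | zero => simp [Strategy.history, h]
  | succ n ih =>
    simp only [Strategy.history, ih fun k hk => h k (hk.trans n.le_succ), h (n + 1) le_rfl]

lemma Strategy.length_history (x : ℕ → Q) (n : ℕ) : (σ.history x n).length = n := by
  induction n with
  | zero => rfl
  | succ n ih => simp [Strategy.history, StateActionSeq.length, ih]

/-- The state at time `n` when the run is frozen once it is in the target set or unsafe. -/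
noncomputable def Strategy.stoppedState (safe tgt : Set Q) (x : ℕ → Q) (n : ℕ) : Q :=
  (σ.history x n).stopped (safe \ tgt)

/-- Freezing makes success by time `n` readable from a single state, so the reach-avoid event
becomes an increasing union of finite-time events. -/
lemma Strategy.stoppedState_mem_iff (safe tgt : Set Q) (x : ℕ → Q) (n : ℕ) :
    (σ.stoppedState safe tgt x n ∈ safe \ tgt ↔ ∀ j ≤ n, x j ∈ safe \ tgt) ∧
    (σ.stoppedState safe tgt x n ∈ tgt ↔ ∃ k ≤ n, x k ∈ tgt ∧ ∀ j < k, x j ∈ safe) := by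
  induction n with
  | zero => simp [Strategy.stoppedState, Strategy.history, stopped]
  | succ n ih =>
    obtain ⟨ih₁, ih₂⟩ := ih
    by_cases h : σ.stoppedState safe tgt x n ∈ safe \ tgt
    · have hs : σ.stoppedState safe tgt x (n + 1) = x (n + 1) := stopped_snoc_of_mem h _ _
      have hn := ih₁.1 h
      rw [hs]
      refine ⟨⟨fun hx j hj => ?_, fun hx => hx _ le_rfl⟩,
        fun hx => ⟨n + 1, le_rfl, hx, fun j hj => (hn j (Nat.lt_succ_iff.1 hj)).1⟩, ?_⟩
      · rcases Nat.le_succ_iff.1 hj with hj | rfl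
        exacts [hn j hj, hx]
      · rintro ⟨k, hk, hkt, -⟩
        rcases Nat.le_succ_iff.1 hk with hk | rfl
        exacts [absurd hkt (hn k hk).2, hkt]
    · have hs : σ.stoppedState safe tgt x (n + 1) = σ.stoppedState safe tgt x n :=
        stopped_snoc_of_notMem h _ _
      rw [hs]
      refine ⟨⟨fun hx => absurd hx h,
        fun hx => absurd (ih₁.2 fun j hj => hx j (hj.trans n.le_succ)) h⟩, ?_⟩
      rw [ih₂]
      refine ⟨fun ⟨k, hk, hx⟩ => ⟨k, hk.trans n.le_succ, hx⟩, ?_⟩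
      rintro ⟨k, hk, hkt, hks⟩
      rcases Nat.le_succ_iff.1 hk with hk | rfl
      · exact ⟨k, hk, hkt, hks⟩
      -- Without an earlier success, a safe prefix cannot have met the target, so the run would not
      -- be frozen at time `n`.
      · by_contra hc
        push Not at hc
        refine h (ih₁.2 fun j hj => ⟨hks j (Nat.lt_succ_iff.2 hj), fun hjt => ?_⟩)
        obtain ⟨i, hi, his⟩ := hc j hj hjt
        exact his (hks i (by omega))

lemma Strategy.setOf_reach_eq_iUnion (safe tgt : Set Q) :
    {x : ℕ → Q | ∃ k, x k ∈ tgt ∧ ∀ j < k, x j ∈ safe} =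
      ⋃ n, {x | σ.stoppedState safe tgt x n ∈ tgt} := by
  ext x
  simp only [mem_ofPred_eq, mem_iUnion, (σ.stoppedState_mem_iff safe tgt x _).2]
  exact ⟨fun ⟨k, hk⟩ => ⟨k, k, le_rfl, hk⟩, fun ⟨_, k, _, hk⟩ => ⟨k, hk⟩⟩

lemma Strategy.monotone_setOf_stoppedState_mem (safe tgt : Set Q) :
    Monotone fun n => {x | σ.stoppedState safe tgt x n ∈ tgt} := by
  intro m n hmn x hx
  simp only [mem_ofPred_eq, (σ.stoppedState_mem_iff safe tgt x _).2] at hx ⊢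
  obtain ⟨k, hk, h⟩ := hx
  exact ⟨k, hk.trans hmn, h⟩

/-- The alternating sequence determined by the states at times `0, …, n`. -/
def Strategy.finiteHistory (n : ℕ) (y : (_ : Finset.Iic n) → Q) : StateActionSeq Q A :=
  σ.history (fun k => y ⟨min k n, Finset.mem_Iic.2 (min_le_right k n)⟩) n

lemma Strategy.finiteHistory_frestrictLe (n : ℕ) (x : ℕ → Q) :
    σ.finiteHistory n (Preorder.frestrictLe n x) = σ.history x n :=
  σ.history_congr fun k hk => by simp [Preorder.frestrictLe_apply, min_eq_left hk]

end History

/-! ### The law of the run -/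

section PathMeasure

variable [Finite Q] [MeasurableSpace Q] [MeasurableSingletonClass Q] {M : RobustMDP Q A}
  (σ : M.Strategy) (ξ : M.Adversary) (q : Q)

instance : IsProbabilityMeasure (M.pathMeasure σ ξ q) := by
  unfold pathMeasure
  infer_instance

lemma Strategy.measurable_comp_history {β : Type*} [MeasurableSpace β]
    (F : StateActionSeq Q A → β) (n : ℕ) : Measurable fun x => F (σ.history x n) := by
  have h : (fun x => F (σ.history x n)) =
      (fun y => F (σ.finiteHistory n y)) ∘ Preorder.frestrictLe (π := fun _ => Q) n := by
    ext x
    simp [σ.finiteHistory_frestrictLe]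
  rw [h]
  exact (measurable_of_countable _).comp (by fun_prop)

/-- Conditioning on the history at time `n`. -/
lemma lintegral_history_succ (G : StateActionSeq Q A → ℝ≥0∞) (n : ℕ) :
    ∫⁻ x, G (σ.history x (n + 1)) ∂M.pathMeasure σ ξ q =
      ∫⁻ x, ∫⁻ r, G (.snoc (σ.history x n) (σ.toFun (σ.history x n)) r)
        ∂(ξ.toFun (σ.history x n) (σ.toFun (σ.history x n))).toMeasure
        ∂M.pathMeasure σ ξ q := by
  let H : ((_ : Finset.Iic n) → Q) × Q → ℝ≥0∞ := fun p =>
    G (.snoc (σ.finiteHistory n p.1) (σ.toFun (σ.finiteHistory n p.1)) p.2)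
  have hH : Measurable H := measurable_of_countable _
  -- The joint law of the states up to `n` and the state at `n + 1` is the law of the former
  -- composed with `stepKernel`.
  have key := Kernel.partialTraj_compProd_eq_map_traj (X := fun _ : ℕ => Q)
    (κ := M.stepKernel σ ξ) n.zero_le (x₀ := fun _ => q)
  have h₁ : ∫⁻ x, G (σ.history x (n + 1)) ∂M.pathMeasure σ ξ q =
      ∫⁻ p, H p ∂(M.pathMeasure σ ξ q).map
        (fun x => (Preorder.frestrictLe (π := fun _ => Q) n x, x (n + 1))) := by
    rw [lintegral_map hH (by fun_prop)]
    simp [H, Strategy.history, σ.finiteHistory_frestrictLe]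
  rw [h₁, pathMeasure, ← key, Measure.lintegral_compProd hH,
    ← Kernel.traj_map_frestrictLe_apply, lintegral_map (measurable_of_countable _) (by fun_prop)]
  refine lintegral_congr fun x => ?_
  change ∫⁻ r, H (_, r) ∂(ξ.toFun (σ.finiteHistory n (Preorder.frestrictLe n x))
    (σ.toFun (σ.finiteHistory n (Preorder.frestrictLe n x)))).toMeasure = _
  simp only [H, σ.finiteHistory_frestrictLe]

lemma lintegral_history_zero (G : StateActionSeq Q A → ℝ≥0∞) :
    ∫⁻ x, G (σ.history x 0) ∂M.pathMeasure σ ξ q = G (.init q) := by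
  have h : (fun x => G (σ.history x 0)) =
      (fun y => G (σ.finiteHistory 0 y)) ∘ Preorder.frestrictLe (π := fun _ => Q) 0 := by
    ext x
    simp [σ.finiteHistory_frestrictLe]
  have h' := lintegral_map (μ := M.pathMeasure σ ξ q) (f := fun y => G (σ.finiteHistory 0 y))
    (g := Preorder.frestrictLe (π := fun _ => Q) 0) (measurable_of_countable _) (by fun_prop)
  rw [h]
  refine h'.symm.trans ?_
  rw [pathMeasure, Kernel.traj_map_frestrictLe_apply, Kernel.partialTraj_self,
    Kernel.id_apply, lintegral_dirac' _ (measurable_of_countable _)]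
  rfl

lemma _root_.PMF.ae_toMeasure_pos (γ : PMF Q) : ∀ᵐ r ∂γ.toMeasure, 0 < γ r := by
  rw [ae_iff, PMF.toMeasure_apply_eq_zero_iff _ (Set.toFinite _).measurableSet]
  rw [Set.disjoint_left]
  intro r hr
  simpa [pos_iff_ne_zero] using hr

/-- Almost surely all finite histories are paths. -/
lemma ae_isPath_history (n : ℕ) : ∀ᵐ x ∂M.pathMeasure σ ξ q, M.IsPath (σ.history x n) := by
  classical
  induction n with
  | zero => exact .of_forall fun _ => trivial
  | succ n ih =>
    let G : StateActionSeq Q A → ℝ≥0∞ := fun ω => if M.IsPath ω then 0 else 1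
    have h : ∫⁻ x, G (σ.history x (n + 1)) ∂M.pathMeasure σ ξ q = 0 := by
      rw [lintegral_history_succ]
      refine (lintegral_congr_ae (ih.mono fun x hx => ?_)).trans lintegral_zero
      refine (lintegral_congr_ae ?_).trans lintegral_zero
      filter_upwards [PMF.ae_toMeasure_pos _] with r hr
      exact if_pos ⟨hx, σ.mem_act _ hx, _, ξ.mem_trans _ hx _ (σ.mem_act _ hx), hr⟩
    rw [lintegral_eq_zero_iff (σ.measurable_comp_history G _)] at h
    filter_upwards [h] with x hx
    by_contra hc
    simp [G, hc] at hx

lemma reachProb_eq_iSup (safe tgt : Set Q) : M.reachProb safe tgt q σ ξ =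
    ⨆ n, M.pathMeasure σ ξ q {x | σ.stoppedState safe tgt x n ∈ tgt} := by
  rw [reachProb, σ.setOf_reach_eq_iUnion]
  exact (σ.monotone_setOf_stoppedState_mem safe tgt).measure_iUnion

end PathMeasure

/-! ### Discounted Bellman operator and value -/

section Bellman

variable [MeasurableSpace Q] (M : RobustMDP Q A) (safe tgt : Set Q)

/-- The worst-case expectation of `v` after action `a` in state `q`. -/
noncomputable def worstExp (v : Q → ℝ≥0∞) (q : Q) (a : A) : ℝ≥0∞ :=
  ⨅ γ ∈ M.trans q a, ∫⁻ r, v r ∂γ.toMeasure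

lemma worstExp_mono {v w : Q → ℝ≥0∞} (h : v ≤ w) (q : Q) (a : A) :
    M.worstExp v q a ≤ M.worstExp w q a :=
  iInf₂_mono fun _ _ => lintegral_mono h

/-- Availability of `a` makes the ambiguity set nonempty; an infimum over the empty set would be
`⊤`. -/
lemma worstExp_le_const {v : Q → ℝ≥0∞} {c : ℝ≥0∞} (h : ∀ r, v r ≤ c) {q : Q} {a : A}
    (ha : a ∈ M.act q) : M.worstExp v q a ≤ c := by
  obtain ⟨γ, hγ⟩ := M.trans_nonempty q a ha
  have := PMF.toMeasure.isProbabilityMeasure γ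
  exact (iInf₂_le γ hγ).trans ((lintegral_mono h).trans (by simp))

lemma worstExp_add_const_le (v : Q → ℝ≥0∞) (c : ℝ≥0∞) (q : Q) (a : A) :
    M.worstExp (fun r => v r + c) q a ≤ M.worstExp v q a + c := by
  simp only [worstExp, ENNReal.iInf_add]
  refine iInf₂_mono fun γ _ => ?_
  have := PMF.toMeasure.isProbabilityMeasure γ
  rw [lintegral_add_right _ measurable_const]
  simp

open Classical in
/-- The robust Bellman operator of the reach-avoid problem with discount factor `l`. -/
noncomputable def bellman (l : ℝ≥0∞) : (Q → ℝ≥0∞) →o (Q → ℝ≥0∞) where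
  toFun v q := if q ∈ tgt then 1 else if q ∈ safe then
    l * ⨆ a ∈ M.act q, M.worstExp v q a else 0
  monotone' v w h q := by
    dsimp only
    split_ifs
    · exact le_rfl
    · gcongr
      exact M.worstExp_mono h _ _
    · exact le_rfl

open Classical in
lemma bellman_apply (l : ℝ≥0∞) (v : Q → ℝ≥0∞) (q : Q) :
    M.bellman safe tgt l v q = if q ∈ tgt then 1 else if q ∈ safe then
      l * ⨆ a ∈ M.act q, M.worstExp v q a else 0 := rfl

/-- The discounted robust value function. -/
noncomputable def value (l : ℝ≥0∞) : Q → ℝ≥0∞ := (M.bellman safe tgt l).lfp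

lemma bellman_value (l : ℝ≥0∞) :
    M.bellman safe tgt l (M.value safe tgt l) = M.value safe tgt l :=
  OrderHom.map_lfp _

variable {tgt} in
lemma value_of_mem_tgt (l : ℝ≥0∞) {q : Q} (hq : q ∈ tgt) : M.value safe tgt l q = 1 := by
  rw [← bellman_value]
  exact if_pos hq

variable {safe tgt} in
lemma value_of_notMem (l : ℝ≥0∞) {q : Q} (hq : q ∉ tgt) (hq' : q ∉ safe) :
    M.value safe tgt l q = 0 := by
  rw [← bellman_value]
  exact (if_neg hq).trans (if_neg hq')

variable {safe tgt} in
lemma value_of_mem_diff (l : ℝ≥0∞) {q : Q} (hq : q ∈ safe \ tgt) :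
    M.value safe tgt l q = l * ⨆ a ∈ M.act q, M.worstExp (M.value safe tgt l) q a := by
  nth_rw 1 [← bellman_value]
  exact (if_neg hq.2).trans (if_pos hq.1)

lemma value_mono : Monotone (M.value safe tgt) := by
  intro l l' h
  refine OrderHom.lfp.monotone fun v q => ?_
  simp only [bellman_apply]
  split_ifs
  · exact le_rfl
  · gcongr
  · exact le_rfl

lemma value_le_one {l : ℝ≥0∞} (hl : l ≤ 1) (q : Q) : M.value safe tgt l q ≤ 1 := by
  refine OrderHom.lfp_le (M.bellman safe tgt l) (a := fun _ => 1) (fun q => ?_) q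
  simp only [bellman_apply]
  split_ifs
  · exact le_rfl
  · exact mul_le_one' hl (iSup₂_le fun a ha => M.worstExp_le_const (fun _ => le_rfl) ha)
  · exact zero_le_one

/-- An action that is available at `q` and maximizes the worst-case expectation of `v`. -/
lemma exists_act_eq_iSup_worstExp [Finite A] (v : Q → ℝ≥0∞) (q : Q) :
    ∃ a ∈ M.act q, ⨆ b ∈ M.act q, M.worstExp v q b ≤ M.worstExp v q a := by
  obtain ⟨a, ha, h⟩ := Set.exists_max_image (M.act q) (M.worstExp v q) (Set.toFinite _)
    (M.act_nonempty q)
  exact ⟨a, ha, iSup₂_le h⟩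

end Bellman

/-! ### Lower bound: greedy stationary strategies -/

section Stationary

variable {M : RobustMDP Q A}

/-- The stationary strategy that plays `f q` in state `q`. -/
def stationary (f : Q → A) (hf : ∀ q, f q ∈ M.act q) : M.Strategy where
  toFun ω := f ω.last
  mem_act ω _ := hf ω.last

variable [Finite Q] [MeasurableSpace Q] [MeasurableSingletonClass Q]

/-- The expectation of `z n` along the frozen run is nondecreasing in `n`; it starts at the
discounted value, and `z n` is at most the indicator of success plus `l ^ n`. -/
lemma value_le_measure_add_pow {safe tgt : Set Q} {l : ℝ≥0∞} (hl : l ≤ 1) (f : Q → A)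
    (hf : ∀ q, f q ∈ M.act q)
    (hmax : ∀ q, ⨆ a ∈ M.act q, M.worstExp (M.value safe tgt l) q a ≤
      M.worstExp (M.value safe tgt l) q (f q)) (ξ : M.Adversary) (q : Q) (n : ℕ) :
    M.value safe tgt l q ≤ M.pathMeasure (stationary f hf) ξ q
      {x | (stationary f hf).stoppedState safe tgt x n ∈ tgt} + l ^ n := by
  classical
  set σ := stationary f hf
  -- Only states outside the target are discounted, so success counts fully whenever it occurs.
  let z : ℕ → Q → ℝ≥0∞ := fun n r => if r ∈ tgt then 1 else l ^ n * M.value safe tgt l r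
  have hz₀ (r : Q) : z 0 r = M.value safe tgt l r := by
    by_cases hr : r ∈ tgt <;> simp [z, hr, value_of_mem_tgt]
  have hstep (n : ℕ) : ∫⁻ x, z n (σ.stoppedState safe tgt x n) ∂M.pathMeasure σ ξ q ≤
      ∫⁻ x, z (n + 1) (σ.stoppedState safe tgt x (n + 1)) ∂M.pathMeasure σ ξ q := by
    refine le_of_le_of_eq ?_ (lintegral_history_succ σ ξ q
      (fun ω => z (n + 1) (ω.stopped (safe \ tgt))) n).symm
    refine lintegral_mono_ae ((ae_isPath_history σ ξ q n).mono fun x hx => ?_)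
    set ω := σ.history x n
    change z n (ω.stopped (safe \ tgt)) ≤ _
    have := PMF.toMeasure.isProbabilityMeasure (ξ.toFun ω (σ.toFun ω))
    by_cases hs : ω.stopped (safe \ tgt) ∈ safe \ tgt
    · simp only [stopped_snoc_of_mem hs]
      calc z n (ω.stopped (safe \ tgt))
          = l ^ (n + 1) * ⨆ a ∈ M.act ω.last, M.worstExp (M.value safe tgt l) ω.last a := by
            have hs' := hs
            rw [stopped_eq_last hs] at hs' ⊢
            simp only [z, if_neg hs'.2]
            rw [M.value_of_mem_diff l hs', pow_succ, mul_assoc]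
        _ ≤ l ^ (n + 1) * ∫⁻ r, M.value safe tgt l r ∂(ξ.toFun ω (σ.toFun ω)).toMeasure := by
            gcongr
            exact (hmax _).trans (iInf₂_le _ (ξ.mem_trans ω hx _ (hf ω.last)))
        _ = ∫⁻ r, l ^ (n + 1) * M.value safe tgt l r
              ∂(ξ.toFun ω (σ.toFun ω)).toMeasure :=
            (lintegral_const_mul _ (measurable_of_countable _)).symm
        _ ≤ _ := by
            refine lintegral_mono fun r => ?_
            by_cases hr : r ∈ tgt
            · simpa [z, hr, M.value_of_mem_tgt safe l hr] using pow_le_one' hl (n + 1)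
            · simp [z, hr]
    · simp only [stopped_snoc_of_notMem hs, lintegral_const, measure_univ, mul_one]
      by_cases hr : ω.stopped (safe \ tgt) ∈ tgt
      · simp [z, hr]
      · simp [z, hr, M.value_of_notMem l hr fun h => hs ⟨h, hr⟩]
  have hall (n : ℕ) : M.value safe tgt l q ≤
      ∫⁻ x, z n (σ.stoppedState safe tgt x n) ∂M.pathMeasure σ ξ q := by
    induction n with
    | zero =>
      rw [← hz₀ q]
      exact (lintegral_history_zero σ ξ q (fun ω => z 0 (ω.stopped (safe \ tgt)))).ge
    | succ n ih => exact ih.trans (hstep n)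
  have hmeas : MeasurableSet {x | σ.stoppedState safe tgt x n ∈ tgt} :=
    measurableSet_setOfPred.2 (σ.measurable_comp_history (fun ω => ω.stopped (safe \ tgt) ∈ tgt) n)
  calc M.value safe tgt l q
      ≤ ∫⁻ x, z n (σ.stoppedState safe tgt x n) ∂M.pathMeasure σ ξ q := hall n
    _ ≤ ∫⁻ x, ({x | σ.stoppedState safe tgt x n ∈ tgt}.indicator 1 x + l ^ n)
          ∂M.pathMeasure σ ξ q := by
        refine lintegral_mono fun x => ?_
        by_cases hr : σ.stoppedState safe tgt x n ∈ tgt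
        · simp [z, hr]
        · simpa [z, hr] using mul_le_of_le_one_right' (M.value_le_one safe tgt hl _)
    _ = _ := by
        rw [lintegral_add_right _ measurable_const, lintegral_indicator_one hmeas]
        simp

/-- Against every adversary, a strategy that is greedy for the discounted value function secures
the discounted value. -/
lemma value_le_worstReachProb {safe tgt : Set Q} {l : ℝ≥0∞} (hl : l < 1) (f : Q → A)
    (hf : ∀ q, f q ∈ M.act q)
    (hmax : ∀ q, ⨆ a ∈ M.act q, M.worstExp (M.value safe tgt l) q a ≤
      M.worstExp (M.value safe tgt l) q (f q)) (q : Q) :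
    M.value safe tgt l q ≤ M.worstReachProb safe tgt q (stationary f hf) := by
  refine le_iInf fun ξ => ?_
  -- Strict discounting is essential here: for `l = 1` the remainder would not vanish.
  have h : Filter.Tendsto (fun n => M.reachProb safe tgt q (stationary f hf) ξ + l ^ n)
      Filter.atTop (nhds (M.reachProb safe tgt q (stationary f hf) ξ + 0)) :=
    tendsto_const_nhds.add (ENNReal.tendsto_pow_atTop_nhds_zero_of_lt_one hl)
  rw [add_zero] at h
  refine ge_of_tendsto' h fun n => (value_le_measure_add_pow hl.le f hf hmax ξ q n).trans ?_
  gcongr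
  rw [reachProb_eq_iSup]
  exact le_iSup (fun n => M.pathMeasure (stationary f hf) ξ q
    {x | (stationary f hf).stoppedState safe tgt x n ∈ tgt}) n

end Stationary

/-! ### Upper bound: nearly worst-case adversaries -/

section UpperBound

variable [Finite Q] [MeasurableSpace Q] [MeasurableSingletonClass Q] {M : RobustMDP Q A}

/-- A supersolution of the undiscounted Bellman equation bounds the worst-case reach-avoid
probability of every strategy. -/
lemma worstReachProb_le {safe tgt : Set Q} {u : Q → ℝ≥0∞} (hu : ∀ q, u q ≤ 1)
    (htgt : ∀ q ∈ tgt, 1 ≤ u q)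
    (hsuper : ∀ q ∈ safe \ tgt, ∀ a ∈ M.act q, M.worstExp u q a ≤ u q)
    (σ : M.Strategy) (q : Q) : M.worstReachProb safe tgt q σ ≤ u q := by
  refine ENNReal.le_of_forall_pos_le_add fun ε hε _ => ?_
  -- The infimum in `worstExp` may not be attained, so the adversary may err by `δ n` at time `n`,
  -- with total error below `ε`.
  obtain ⟨δ, hδ, hδε⟩ := ENNReal.exists_pos_sum_of_countable' (ENNReal.coe_pos.2 hε).ne' ℕ
  have hex (ω : StateActionSeq Q A) (a : A) : ∃ γ : PMF Q, M.IsPath ω → a ∈ M.act ω.last →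
      γ ∈ M.trans ω.last a ∧ ∫⁻ r, u r ∂γ.toMeasure ≤ M.worstExp u ω.last a + δ ω.length := by
    by_cases ha : a ∈ M.act ω.last
    · have hlt : M.worstExp u ω.last a < M.worstExp u ω.last a + δ ω.length :=
        ENNReal.lt_add_right
          ((M.worstExp_le_const hu ha).trans_lt ENNReal.one_lt_top).ne (hδ _).ne'
      obtain ⟨γ, hγ⟩ := iInf_lt_iff.1 hlt
      obtain ⟨hγ, h⟩ := iInf_lt_iff.1 hγ
      exact ⟨γ, fun _ _ => ⟨hγ, h.le⟩⟩
    · exact ⟨PMF.pure ω.last, fun _ h => absurd h ha⟩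
  choose g hg using hex
  let ξ : M.Adversary := ⟨g, fun ω hω a ha => (hg ω a hω ha).1⟩
  refine (iInf_le _ ξ).trans ?_
  have hstep (n : ℕ) : ∫⁻ x, u (σ.stoppedState safe tgt x (n + 1)) ∂M.pathMeasure σ ξ q ≤
      ∫⁻ x, u (σ.stoppedState safe tgt x n) ∂M.pathMeasure σ ξ q + δ n := by
    have h₁ : ∫⁻ x, u (σ.stoppedState safe tgt x n) ∂M.pathMeasure σ ξ q + δ n =
        ∫⁻ x, (u (σ.stoppedState safe tgt x n) + δ n) ∂M.pathMeasure σ ξ q := by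
      rw [lintegral_add_right _ measurable_const]
      simp
    rw [h₁]
    refine (lintegral_history_succ σ ξ q (fun ω => u (ω.stopped (safe \ tgt))) n).trans_le ?_
    refine lintegral_mono_ae ((ae_isPath_history σ ξ q n).mono fun x hx => ?_)
    have hlen := σ.length_history x n
    set ω := σ.history x n
    change _ ≤ u (ω.stopped (safe \ tgt)) + δ n
    have := PMF.toMeasure.isProbabilityMeasure (ξ.toFun ω (σ.toFun ω))
    by_cases hs : ω.stopped (safe \ tgt) ∈ safe \ tgt
    · simp only [stopped_snoc_of_mem hs]
      refine (hg ω _ hx (σ.mem_act ω hx)).2.trans ?_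
      rw [hlen]
      gcongr
      have hs' := hs
      rw [stopped_eq_last hs] at hs' ⊢
      exact hsuper _ hs' _ (σ.mem_act ω hx)
    · simp only [stopped_snoc_of_notMem hs, lintegral_const, measure_univ, mul_one]
      exact le_self_add
  have hall (n : ℕ) : ∫⁻ x, u (σ.stoppedState safe tgt x n) ∂M.pathMeasure σ ξ q ≤
      u q + ∑ i ∈ Finset.range n, δ i := by
    induction n with
    | zero =>
      rw [Finset.sum_range_zero, add_zero]
      exact (lintegral_history_zero σ ξ q (fun ω => u (ω.stopped (safe \ tgt)))).le
    | succ n ih =>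
      rw [Finset.sum_range_succ, ← add_assoc]
      exact (hstep n).trans (by gcongr)
  rw [reachProb_eq_iSup]
  refine iSup_le fun n => ?_
  have hmeas : MeasurableSet {x | σ.stoppedState safe tgt x n ∈ tgt} :=
    measurableSet_setOfPred.2 (σ.measurable_comp_history (fun ω => ω.stopped (safe \ tgt) ∈ tgt) n)
  calc M.pathMeasure σ ξ q {x | σ.stoppedState safe tgt x n ∈ tgt}
      = ∫⁻ x, {x | σ.stoppedState safe tgt x n ∈ tgt}.indicator 1 x ∂M.pathMeasure σ ξ q :=
        (lintegral_indicator_one hmeas).symm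
    _ ≤ ∫⁻ x, u (σ.stoppedState safe tgt x n) ∂M.pathMeasure σ ξ q :=
        lintegral_mono (indicator_le fun _ hx => htgt _ hx)
    _ ≤ u q + ∑ i ∈ Finset.range n, δ i := hall n
    _ ≤ u q + ε := by
        gcongr
        exact (ENNReal.sum_le_tsum _).trans hδε.le

end UpperBound

/-! ### The limit of vanishing discount -/

section Limit

variable [Finite Q] [MeasurableSpace Q] {M : RobustMDP Q A}

/-- The limit of the discounted values is a supersolution of the undiscounted Bellman
equation. -/
lemma worstExp_iSup_value_le {safe tgt : Set Q} {l : ℕ → ℝ≥0∞} (hmono : Monotone l)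
    (hl : ∀ k, l k ≤ 1) (hlim : Filter.Tendsto l Filter.atTop (nhds 1)) {q : Q}
    (hq : q ∈ safe \ tgt) {a : A} (ha : a ∈ M.act q) :
    M.worstExp (fun r => ⨆ k, M.value safe tgt (l k) r) q a ≤ ⨆ k, M.value safe tgt (l k) q := by
  set u : Q → ℝ≥0∞ := fun r => ⨆ k, M.value safe tgt (l k) r
  have hvm (r : Q) : Monotone fun k => M.value safe tgt (l k) r :=
    fun i j hij => M.value_mono safe tgt (hmono hij) r
  have hbound (k : ℕ) : l k * M.worstExp u q a ≤ u q := by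
    refine ENNReal.le_of_forall_pos_le_add fun ε hε _ => ?_
    -- Since `Q` is finite, one index `j` serves all states; this uniformity lets the supremum pass
    -- through the infimum over distributions.
    have hclose (r : Q) : ∀ᶠ j in Filter.atTop, u r ≤ M.value safe tgt (l j) r + ε := by
      have hur : u r ≠ ⊤ :=
        ((iSup_le fun j => M.value_le_one safe tgt (hl j) r).trans_lt ENNReal.one_lt_top).ne
      have ht := (tendsto_atTop_iSup (hvm r)).add_const (ε : ℝ≥0∞)
      exact (ht.eventually_const_lt (ENNReal.lt_add_right hur
        (ENNReal.coe_pos.2 hε).ne')).mono fun j hj => hj.le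
    obtain ⟨j, hj, hkj⟩ :=
      ((Filter.eventually_all.2 hclose).and (Filter.eventually_ge_atTop k)).exists
    calc l k * M.worstExp u q a
        ≤ l j * (M.worstExp (M.value safe tgt (l j)) q a + ε) := by
          gcongr
          · exact hmono hkj
          · exact (M.worstExp_mono hj q a).trans (M.worstExp_add_const_le _ _ q a)
      _ ≤ l j * (⨆ b ∈ M.act q, M.worstExp (M.value safe tgt (l j)) q b) + 1 * ε := by
          rw [mul_add]
          gcongr
          · exact le_iSup₂ (f := fun b _ => M.worstExp (M.value safe tgt (l j)) q b) a ha
          · exact hl j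
      _ ≤ u q + ε := by
          rw [← M.value_of_mem_diff _ hq, one_mul]
          gcongr
          exact le_iSup (fun j => M.value safe tgt (l j) q) j
  have ht : Filter.Tendsto (fun k => l k * M.worstExp u q a) Filter.atTop
      (nhds (1 * M.worstExp u q a)) :=
    ENNReal.Tendsto.mul_const hlim (.inl one_ne_zero)
  rw [one_mul] at ht
  exact le_of_tendsto' ht hbound

end Limit

end RobustMDP

/-! ### Conclusion -/

theorem mainTheorem8 {Q A : Type*} [Finite Q] [MeasurableSpace Q] [MeasurableSingletonClass Q]
    [Finite A] (M : RobustMDP Q A) (safe tgt : Set Q) (htgt : tgt ⊆ safe) :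
    ∃ σ : M.Strategy, σ.IsStationary ∧ σ.IsOptimal safe tgt := by
  obtain ⟨l, hmono, hmem, hlim⟩ :=
    exists_seq_strictMono_tendsto' (zero_lt_one : (0 : ℝ≥0∞) < 1)
  have hl (k : ℕ) : l k < 1 := (hmem k).2
  choose f hf hmax using fun k q => M.exists_act_eq_iSup_worstExp (M.value safe tgt (l k)) q
  -- Pigeonhole: one map `φ` is greedy for arbitrarily late discount factors.
  obtain ⟨φ, hφ⟩ := Finite.exists_infinite_fiber f
  have hφ' (k : ℕ) : ∃ j ≥ k, f j = φ := by
    obtain ⟨j, hj, hkj⟩ := (Set.infinite_coe_iff.1 hφ).exists_gt k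
    exact ⟨j, hkj.le, hj⟩
  have hφa (q : Q) : φ q ∈ M.act q := by
    obtain ⟨j, -, rfl⟩ := hφ' 0
    exact hf j q
  refine ⟨RobustMDP.stationary φ hφa, ⟨φ, fun _ _ => rfl⟩, fun q σ _ => ?_⟩
  calc M.worstReachProb safe tgt q σ
      ≤ ⨆ k, M.value safe tgt (l k) q :=
        RobustMDP.worstReachProb_le (u := fun r => ⨆ k, M.value safe tgt (l k) r)
          (fun r => iSup_le fun k => M.value_le_one safe tgt (hl k).le r)
          (fun r hr => le_iSup_of_le 0 (M.value_of_mem_tgt safe (l 0) hr).ge)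
          (fun r hr a ha =>
            RobustMDP.worstExp_iSup_value_le hmono.monotone (fun k => (hl k).le) hlim hr ha)
          σ q
    _ ≤ M.worstReachProb safe tgt q (RobustMDP.stationary φ hφa) := by
        refine iSup_le fun k => ?_
        obtain ⟨j, hkj, rfl⟩ := hφ' k
        exact (M.value_mono safe tgt (hmono.monotone hkj) q).trans
          (RobustMDP.value_le_worstReachProb (hl j) (f j) hφa (hmax j) q)
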